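/- Let $\mathcal C$ be a small preadditive category having at least one nonzero object (an object whose identity morphism is nonzero); write $\mathcal C_0$ for its set of objects, $\mathcal C(A,B)$ for the group of morphisms $A\to B$, and $\mathrm{Fun}(\mathcal C^{op},\mathcal Ab)$ for the category of additive contravariant functors from $\mathcal C$ to abelian groups. Definitions. $\mathcal C$ is *simple* if $\mathcal C(-,-)$ is nonzero and is the only nonzero additive subfunctor of the bifunctor $\mathcal C(-,-):\mathcal C^{op}\times\mathcal C\to\mathcal Ab$; $\mathcal C$ is *(right) artinian* if for every $A\in\mathcal C_0$ the subobjects of $\mathcal C(-,A)$ in $\mathrm{Fun}(\mathcal C^{op},\mathcal Ab)$ satisfy the descending chain condition; $\mathcal C$ is *simple artinian* if it is right artinian and simple; $\mathcal C$ is *semisimple* if for every $A\in\mathcal C_0$ the functor $\mathcal C(-,A)$ is a (possibly empty) coproduct of simple objects of $\mathrm{Fun}(\mathcal C^{op},\mathcal Ab)$. The ring of $\mathcal C$ is the (not necessarily unital) ring $R[\mathcal C]=\bigoplus_{A,B\in\mathcal C_0}\mathcal C(B,A)$, where the product $fg$ of two morphisms is $f\circ g$ if the composite is defined and $0$ otherwise;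 it is graded by the groupoid $\mathcal G=\mathcal C_0\times\mathcal C_0$ via $R[\mathcal C]_{(A,B)}=\mathcal C(B,A)$. It is *gr-simple* if it is nonzero and its only graded two-sided ideals are $0$ and $R[\mathcal C]$, and *$\mathcal G_0$-artinian* if for each $A\in\mathcal C_0$ the graded right ideals contained in $\bigoplus_{B}R[\mathcal C]_{(A,B)}$ satisfy the descending chain condition. For a unital ring $R$, $\mathrm{mod}\text{-}R$ denotes the category of finitely generated right $R$-modules. Isomorphisms of preadditive categories are additive. Then the following assertions are equivalent. 1. $\mathcal C$ is a simple artinian category. 2. $\mathcal C$ is a simple and semisimple category. 3. $R[\mathcal C]$ is a gr-simple $\mathcal G_0$-artinian ring. 4. There exist a division ring $D$, a function $n:\mathcal C_0\to\mathbb Z_{\ge 0}$ and, for all $A,B\in\mathcal C_0$, an isomorphism of additive groups $\varphi_{(A,B)}:\mathcal C(A,B)\to M_{n(B)\times n(A)}(D)$, such that $\varphi_{(A,B)}(fg)=\varphi_{(X,B)}(f)\cdot\varphi_{(A,X)}(g)$ for all $f\in\mathcal C(X,B)$ and $g\in\mathcal C(A,X)$. 5. There exists a division ring $D$ such that $\mathcal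 C$ is isomorphic to a small full subcategory of $\mathrm{mod}\text{-}D$. 6. There exists a simple artinian ring $R$ such that $\mathcal C$ is isomorphic to a small full subcategory of $\mathrm{mod}\text{-}R$. -/

import Mathlib

open CategoryTheory CategoryTheory.Limits Opposite
open scoped DirectSum

universe w v u

noncomputable section

namespace PreaddCat

section RingOfCategory

variable (C : Type u) [Category.{v} C] [Preadditive C]

/-- The underlying additive group of the ring `R[C]` of a small preadditive category `C`:
the direct sum of all morphism groups.  It is graded by the pair groupoid `C₀ × C₀`; the
component of degree `(A, B)` is `C(B, A)`, i.e. the group of morphisms `B ⟶ A`. -/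
def CatRing : Type (max u v) := ⨁ p : C × C, (p.2 ⟶ p.1)

instance : AddCommGroup (CatRing C) :=
  inferInstanceAs (AddCommGroup (⨁ p : C × C, (p.2 ⟶ p.1)))

variable {C}

namespace CatRing

/-- The homogeneous component of degree `p` of an element of `R[C]`. -/
def coeff (p : C × C) : CatRing C →+ (p.2 ⟶ p.1) :=
  DFinsupp.evalAddMonoidHom p

open scoped Classical in
/-- The inclusion of the homogeneous component of degree `p` into `R[C]`. -/
def of (p : C × C) : (p.2 ⟶ p.1) →+ CatRing C :=
  DirectSum.of (fun p : C × C => (p.2 ⟶ p.1)) p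

open scoped Classical in
/-- The additive map on `R[C]` given by additive maps on the homogeneous components. -/
def lift {M : Type*} [AddCommMonoid M] (φ : ∀ p : C × C, (p.2 ⟶ p.1) →+ M) : CatRing C →+ M :=
  DirectSum.toAddMonoid φ

theorem lift_of {M : Type*} [AddCommMonoid M] (φ : ∀ p : C × C, (p.2 ⟶ p.1) →+ M)
    (p : C × C) (f : p.2 ⟶ p.1) : lift φ (of p f) = φ p f := by
  classical
  exact DirectSum.toAddMonoid_of φ p f

open scoped Classical in
/-- The product `C(p.2, p.1) × C(q.2, q.1) → R[C]` on homogeneous components: the composite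
`f ∘ g` if it is defined (that is, if `q.1 = p.2`), and `0` otherwise. -/
def homMul (p q : C × C) : (p.2 ⟶ p.1) →+ (q.2 ⟶ q.1) →+ CatRing C :=
  if h : q.1 = p.2 then
    AddMonoidHom.mk' (fun f => AddMonoidHom.mk' (fun g =>
        of (p.1, q.2) (g ≫ eqToHom h ≫ f))
      (fun g g' => by rw [Preadditive.add_comp, map_add]))
      (fun f f' => by
        ext g
        simp only [AddMonoidHom.mk'_apply, AddMonoidHom.add_apply]
        rw [Preadditive.comp_add, Preadditive.comp_add, map_add])
  else 0

/-- The multiplication of `R[C]`, the biadditive extension of `homMul`. -/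
def mulHom : CatRing C →+ CatRing C →+ CatRing C :=
  lift (fun p => (lift (fun q => (homMul p q).flip)).flip)

instance : Mul (CatRing C) := ⟨fun x y => mulHom x y⟩

theorem mul_def (x y : CatRing C) : x * y = mulHom x y := rfl

theorem of_mul_of (p q : C × C) (f : p.2 ⟶ p.1) (g : q.2 ⟶ q.1) :
    of p f * of q g = homMul p q f g := by
  rw [mul_def, mulHom, lift_of, AddMonoidHom.flip_apply, lift_of, AddMonoidHom.flip_apply]

/-- The product of two composable morphisms is their composite. -/
theorem of_mul_of_comp {X Y Z : C} (f : Y ⟶ X) (g : Z ⟶ Y) :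
    of (X, Y) f * of (Y, Z) g = of (X, Z) (g ≫ f) := by
  rw [of_mul_of]
  simp [homMul]

/-- The product of two non-composable morphisms is zero. -/
theorem of_mul_of_ne {p q : C × C} (h : q.1 ≠ p.2) (f : p.2 ⟶ p.1) (g : q.2 ⟶ q.1) :
    of p f * of q g = 0 := by
  rw [of_mul_of]
  simp [homMul, h]


protected theorem induction {motive : CatRing C → Prop} (x : CatRing C)
    (zero : motive 0) (of : ∀ (p : C × C) (f : p.2 ⟶ p.1), motive (of p f))
    (add : ∀ x y, motive x → motive y → motive (x + y)) : motive x := by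
  classical
  exact DirectSum.induction_on x zero of add

instance : NonUnitalNonAssocRing (CatRing C) where
  left_distrib x y z := map_add (mulHom x) y z
  right_distrib x y z := by simp only [mul_def, map_add, AddMonoidHom.add_apply]
  zero_mul x := by simp only [mul_def, map_zero, AddMonoidHom.zero_apply]
  mul_zero x := map_zero (mulHom x)

theorem of_mul_of_assoc (p q r : C × C) (f : p.2 ⟶ p.1) (g : q.2 ⟶ q.1) (k : r.2 ⟶ r.1) :
    of p f * of q g * of r k = of p f * (of q g * of r k) := by
  obtain ⟨a, b⟩ := p
  obtain ⟨c, d⟩ := q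
  obtain ⟨e, t⟩ := r
  by_cases h : c = b
  · subst h
    by_cases h' : e = d
    · subst h'
      rw [of_mul_of_comp, of_mul_of_comp, of_mul_of_comp, of_mul_of_comp, Category.assoc]
    · rw [of_mul_of_comp, of_mul_of_ne (p := (a, d)) (q := (e, t)) h',
        of_mul_of_ne (p := (c, d)) (q := (e, t)) h', mul_zero]
  · rw [of_mul_of_ne (p := (a, b)) (q := (c, d)) h, zero_mul]
    by_cases h' : e = d
    · subst h'
      rw [of_mul_of_comp, of_mul_of_ne (p := (a, b)) (q := (c, t)) h]
    · rw [of_mul_of_ne (p := (c, d)) (q := (e, t)) h', mul_zero]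

/-- `R[C]` is an associative ring, in general without identity. -/
instance : NonUnitalRing (CatRing C) where
  mul_assoc x y z := by
    induction x using CatRing.induction with
    | zero => simp only [zero_mul]
    | add x x' hx hx' => simp only [add_mul, hx, hx']
    | of p f =>
      induction y using CatRing.induction with
      | zero => simp only [zero_mul, mul_zero]
      | add y y' hy hy' => simp only [add_mul, mul_add, hy, hy']
      | of q g =>
        induction z using CatRing.induction with
        | zero => simp only [mul_zero]
        | add z z' hz hz' => simp only [mul_add, hz, hz']
        | of r k => exact of_mul_of_assoc p q r f g k

/-- An additive subgroup `N` of `R[C]` is graded if it contains the homogeneous components of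
each of its elements, i.e. `N` is the direct sum of its intersections with the homogeneous
components of `R[C]`. -/
def IsGraded (N : AddSubgroup (CatRing C)) : Prop :=
  ∀ x ∈ N, ∀ p : C × C, of p (coeff p x) ∈ N

/-- Graded right ideals of `R[C]`. -/
structure IsGradedRightIdeal (N : AddSubgroup (CatRing C)) : Prop where
  mul_mem : ∀ x ∈ N, ∀ r : CatRing C, x * r ∈ N
  graded : IsGraded N

/-- Graded (two-sided) ideals of `R[C]`. -/
structure IsGradedIdeal (N : AddSubgroup (CatRing C)) : Prop where
  mul_mem : ∀ x ∈ N, ∀ r : CatRing C, x * r ∈ N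
  mul_mem_left : ∀ x ∈ N, ∀ r : CatRing C, r * x ∈ N
  graded : IsGraded N

/-- The graded right ideal `R[C](ε_A)`, the direct sum of the homogeneous components whose
degree `p` has range `A`. -/
def row (A : C) : AddSubgroup (CatRing C) where
  carrier := {x | ∀ p : C × C, p.1 ≠ A → coeff p x = 0}
  zero_mem' p _ := map_zero (coeff p)
  add_mem' hx hy p hp := by rw [map_add, hx p hp, hy p hp, add_zero]
  neg_mem' hx p hp := by rw [map_neg, hx p hp, neg_zero]

end CatRing

variable (C)

/-- `R[C]` is gr-simple: it is nonzero and its only graded ideals are `0` and `R[C]`. -/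
def GrSimpleCatRing : Prop :=
  Nontrivial (CatRing C) ∧
    ∀ N : AddSubgroup (CatRing C), CatRing.IsGradedIdeal N → N = ⊥ ∨ N = ⊤

/-- `R[C]` is (right) `𝒢₀`-artinian, where `𝒢 = C₀ × C₀`: for each object `A`, the graded right
module `R[C](ε_A)` satisfies the descending chain condition on graded submodules. -/
def ArtinianCatRing : Prop :=
  ∀ (A : C) (N : ℕ → AddSubgroup (CatRing C)), Antitone N →
    (∀ i, CatRing.IsGradedRightIdeal (N i)) → (∀ i, N i ≤ CatRing.row A) →
    ∃ m, ∀ i, m ≤ i → N i = N m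

end RingOfCategory

section Category

variable (C : Type u) [Category.{v} C] [Preadditive C]

/-- An ideal of `C`: an additive subfunctor of the bifunctor `C(-,-) : Cᵒᵖ × C ⥤ Ab`. -/
structure CatIdeal where
  carrier : ∀ A B : C, AddSubgroup (A ⟶ B)
  comp_mem : ∀ {A' A B B' : C} (f : A' ⟶ A) (m : A ⟶ B) (g : B ⟶ B'),
    m ∈ carrier A B → f ≫ m ≫ g ∈ carrier A' B'

/-- `C` is a simple category: `C(-,-)` is nonzero and it is the only nonzero ideal of `C`. -/
def SimpleCategory : Prop :=
  (∃ (A B : C) (f : A ⟶ B), f ≠ 0) ∧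
    ∀ I : CatIdeal C, (∀ A B, I.carrier A B = ⊥) ∨ (∀ A B, I.carrier A B = ⊤)

variable {C} in
/-- The contravariant functor `C(-,A)` as an object of the category `Fun(Cᵒᵖ, Ab)` of additive
functors. -/
def representable (A : C) : Cᵒᵖ ⥤+ AddCommGrpCat.{v} :=
  AdditiveFunctor.of (preadditiveYoneda.obj A)

/-- `C` is right artinian: each `C(-,A)` is an artinian object of `Fun(Cᵒᵖ, Ab)`. -/
def RightArtinianCategory : Prop :=
  ∀ A : C, IsArtinianObject (representable A)

/-- An object of a category is semisimple if it is a coproduct of a family of simple objects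
(the family may be empty). -/
def IsSemisimpleObject {𝒜 : Type*} [Category* 𝒜] [HasZeroMorphisms 𝒜] (X : 𝒜) : Prop :=
  ∃ (ι : Type w) (S : ι → 𝒜) (i : ∀ j, S j ⟶ X),
    (∀ j, Simple (S j)) ∧ Nonempty (IsColimit (Cofan.mk X i))

/-- `C` is (right) semisimple: each `C(-,A)` is a semisimple object of `Fun(Cᵒᵖ, Ab)`. -/
def SemisimpleCategory : Prop :=
  ∀ A : C, IsSemisimpleObject.{v} (representable A)

/-- `C` is a simple artinian category. -/
def SimpleArtinianCategory : Prop :=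
  RightArtinianCategory C ∧ SimpleCategory C

end Category

section Modules

/-- Finitely generated right modules over the unital ring `R` whose underlying set is a subset
of the ambient set `Ω`.  (Right `R`-modules are modules over the opposite ring.)  Every set of
modules consists of modules whose underlying sets lie in a common set `Ω`. -/
structure FGModIn (R : Type v) [Ring R] (Ω : Type w) where
  carrier : Set Ω
  [addCommGroup : AddCommGroup carrier]
  [module : Module Rᵐᵒᵖ carrier]
  [finite : Module.Finite Rᵐᵒᵖ carrier]

attribute [instance] FGModIn.addCommGroup FGModIn.module FGModIn.finite

/-- The module over `Rᵐᵒᵖ` underlying an object of `FGModIn R Ω`. -/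
def FGModIn.toModuleCat {R : Type v} [Ring R] {Ω : Type w} (M : FGModIn R Ω) :
    ModuleCat.{w} Rᵐᵒᵖ :=
  ModuleCat.of Rᵐᵒᵖ M.carrier

/-- The small full subcategory of the category of right `R`-modules whose set of objects is the
given set `P` of finitely generated modules. -/
abbrev FullSubcatOn {R : Type v} [Ring R] {Ω : Type w} (P : Set (FGModIn R Ω)) :
    Type (max v w) :=
  InducedCategory (ModuleCat.{w} Rᵐᵒᵖ) (fun M : P => FGModIn.toModuleCat M.1)

/-- Two preadditive categories are isomorphic: there is an additive functor between them which
is bijective on objects and on morphisms. -/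
def PreadditiveIso (C : Type*) [Category* C] [Preadditive C]
    (E : Type*) [Category* E] [Preadditive E] : Prop :=
  ∃ F : C ⥤ E, F.Additive ∧ F.Full ∧ F.Faithful ∧ Function.Bijective F.obj

/-- `C` is isomorphic to a small full subcategory of the category of finitely generated right
`R`-modules. -/
def IsoToFullSubcatFGMod (C : Type u) [Category.{v} C] [Preadditive C]
    (R : Type v) [Ring R] : Prop :=
  ∃ (Ω : Type (max u v)) (P : Set (FGModIn R Ω)), PreadditiveIso C (FullSubcatOn P)

end Modules

end PreaddCat

end

/-! Each of (1), (2) and (3) yields a simple morphism `s`, that is, a minimal right ideal `sC` of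
the category: from a simple subobject of some `C(-,A)`, from a simple summand of it, or by the
descending chain condition on principal right ideals of `R[C]` (the three `exists_isSimpleMor`).

Once such an `s` exists, simplicity takes over. As in Brauer's lemma, a minimal right ideal is
generated by an idempotent `e` (`IsSimpleMor.exists_idempotent`). Let `P` be the object of the
Karoubi envelope cut out by `e`. By Schur's argument `End P` is a division ring. The ideal generated
by `e` is everything, so each identity is a finite sum `∑ aᵢ ≫ e ≫ bᵢ`, and every object of `C` is a
summand of a finite power of `P`. Hence `Hom(P,-)` is fully faithful on `C`, with finitely generated
values (`IsSimpleMor.exists_divisionRing`); this is (5), which gives (6) because a division ring is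
simple artinian.

Over a simple artinian ring every finitely generated module is a power of one simple module, so
linear maps are matrices over its endomorphism ring: (4). From the matrices everything else is
computed: elementary matrices give simplicity, columns identify right ideals with subspaces of a
finite-dimensional space (chain conditions), and rows split `C(-,A)` into simple functors. The
implications thus run from (1), (2), (3) to (5), (6), (4) and back. -/

noncomputable section

namespace PreaddCat

/-! ### Minimal right ideals, idempotents and Schur's lemma. -/

section SimpleMorphisms

variable {C : Type u} [Category.{v} C] [Preadditive C]

/-- A nonzero morphism `s` is simple if the right ideal `s C` is minimal, i.e. it is generated by
each of its nonzero elements. -/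
def IsSimpleMor {B A : C} (s : B ⟶ A) : Prop :=
  s ≠ 0 ∧ ∀ ⦃B' : C⦄ (g : B' ⟶ B), g ≫ s ≠ 0 → ∃ h : B ⟶ B', h ≫ g ≫ s = s

/-- The two-sided ideal generated by a morphism. -/
def idealSpan {B A : C} (s : B ⟶ A) : CatIdeal C where
  carrier X Y := AddSubgroup.closure {f | ∃ (a : X ⟶ B) (b : A ⟶ Y), f = a ≫ s ≫ b}
  comp_mem {X' X Y Y'} f m g hm := by
    induction hm using AddSubgroup.closure_induction with
    | mem x hx =>
      obtain ⟨a, b, rfl⟩ := hx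
      exact AddSubgroup.subset_closure ⟨f ≫ a, b ≫ g, by simp⟩
    | zero => simp
    | add x y _ _ hx hy =>
      rw [Preadditive.add_comp, Preadditive.comp_add]
      exact add_mem hx hy
    | neg x _ hx =>
      rw [Preadditive.neg_comp, Preadditive.comp_neg]
      exact neg_mem hx

theorem exists_sum_of_mem_idealSpan {B A X Y : C} {s : B ⟶ A} {f : X ⟶ Y}
    (hf : f ∈ (idealSpan s).carrier X Y) :
    ∃ (ι : Type) (_ : Fintype ι) (a : ι → (X ⟶ B)) (b : ι → (A ⟶ Y)),
      f = ∑ i, a i ≫ s ≫ b i := by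
  change f ∈ AddSubgroup.closure _ at hf
  induction hf using AddSubgroup.closure_induction with
  | mem x hx =>
    obtain ⟨a, b, rfl⟩ := hx
    exact ⟨Unit, inferInstance, fun _ => a, fun _ => b, by simp⟩
  | zero => exact ⟨Empty, inferInstance, Empty.elim, Empty.elim, by simp⟩
  | add x y _ _ hx hy =>
    obtain ⟨ι, _, a, b, rfl⟩ := hx
    obtain ⟨κ, _, a', b', rfl⟩ := hy
    exact ⟨ι ⊕ κ, inferInstance, Sum.elim a a', Sum.elim b b', by simp⟩
  | neg x _ hx =>
    obtain ⟨ι, _, a, b, rfl⟩ := hx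
    exact ⟨ι, inferInstance, fun i => -a i, b, by simp⟩

/-- The ideal generated by `s` contains `s`, so it is not zero and must be all of `C`. Applied to
identities, this is the way simplicity enters the structure theory. -/
theorem SimpleCategory.exists_sum (hC : SimpleCategory C) {B A : C} {s : B ⟶ A} (hs : s ≠ 0)
    {X Y : C} (f : X ⟶ Y) :
    ∃ (ι : Type) (_ : Fintype ι) (a : ι → (X ⟶ B)) (b : ι → (A ⟶ Y)),
      f = ∑ i, a i ≫ s ≫ b i := by
  apply exists_sum_of_mem_idealSpan
  rcases hC.2 (idealSpan s) with h | h
  · have hmem : s ∈ (idealSpan s).carrier B A :=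
      AddSubgroup.subset_closure ⟨𝟙 _, 𝟙 _, by simp⟩
    rw [h] at hmem
    exact absurd (AddSubgroup.mem_bot.1 hmem) hs
  · rw [h]
    trivial

/-- In a simple category a minimal right ideal is generated by an idempotent. -/
theorem IsSimpleMor.exists_idempotent (hC : SimpleCategory C) {B A : C} {s : B ⟶ A}
    (hs : IsSimpleMor s) : ∃ e : A ⟶ A, e ≫ e = e ∧ IsSimpleMor e := by
  obtain ⟨hs0, hmin⟩ := hs
  -- The right ideal `sC` has nonzero square: otherwise writing `𝟙 A` as a sum of terms `a ≫ s ≫ b`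
  -- would give `s = s ≫ 𝟙 A = 0`.
  have h1 : ∃ a : A ⟶ B, s ≫ a ≫ s ≠ 0 := by
    by_contra! H
    obtain ⟨ι, _, a, b, h⟩ := hC.exists_sum hs0 (𝟙 A)
    apply hs0
    rw [← Category.comp_id s, h, Preadditive.comp_sum]
    refine Finset.sum_eq_zero fun i _ => ?_
    rw [← Category.assoc (a i), ← Category.assoc s, H, zero_comp]
  obtain ⟨a, ha⟩ := h1
  obtain ⟨h, hh⟩ := hmin (s ≫ a) (by simpa using ha)
  simp only [Category.assoc] at hh
  -- Composition with `a ≫ s` is injective on `sC`: a nonzero `w ≫ s` generates `s`, so killing it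
  -- would kill `s`.
  have hinj : ∀ w : A ⟶ B, w ≫ s ≫ a ≫ s = 0 → w ≫ s = 0 := by
    intro w hw
    by_contra hne
    obtain ⟨k, hk⟩ := hmin w hne
    apply ha
    calc s ≫ a ≫ s = (k ≫ w ≫ s) ≫ a ≫ s := by rw [hk]
      _ = 0 := by rw [Category.assoc, Category.assoc, hw, comp_zero]
  -- This `e` is the element of `sC` with `e ≫ (a ≫ s) = a ≫ s`; hence `e ≫ e - e` is killed by `a ≫
  -- s`, and injectivity gives `e ≫ e = e`.
  refine ⟨a ≫ h ≫ s, ?_, ?_, ?_⟩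
  · have := hinj (a ≫ h ≫ s ≫ a ≫ h - a ≫ h) (by
      simp only [Preadditive.sub_comp, Category.assoc, hh, sub_self])
    rw [Preadditive.sub_comp, sub_eq_zero] at this
    simpa only [Category.assoc] using this
  · intro h0
    apply ha
    have : s ≫ (a ≫ h ≫ s) ≫ a ≫ s = s ≫ a ≫ s := by
      simp only [Category.assoc, hh]
    rw [← this, h0, zero_comp, comp_zero]
  · intro B' g hg
    obtain ⟨k, hk⟩ := hmin (g ≫ a ≫ h) (by simpa only [Category.assoc] using hg)
    simp only [Category.assoc] at hk
    exact ⟨a ≫ h ≫ k, by simp only [Category.assoc, hk]⟩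

open Idempotents

/-- Schur's lemma, one-sided: `x.f` is a nonzero element of the minimal right ideal of `P.p`, so it
generates `P.p`. The multiplier is made an endomorphism of `P` by composing with `P.p` on both
sides. -/
theorem exists_comp_eq_id_of_isSimpleMor (P : Karoubi C) (hP : IsSimpleMor P.p) (x : P ⟶ P)
    (hx : x ≠ 0) : ∃ y : P ⟶ P, y ≫ x = 𝟙 P := by
  have hx0 : x.f ≫ P.p ≠ 0 := by
    rw [Karoubi.comp_p]
    exact fun h => hx (Karoubi.hom_eq_zero_iff.2 h)
  obtain ⟨h, hh⟩ := hP.2 x.f hx0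
  rw [Karoubi.comp_p] at hh
  refine ⟨⟨P.p ≫ h ≫ P.p, by simp⟩, ?_⟩
  ext
  simp [hh]

theorem isUnit_or_eq_zero_of_isSimpleMor (P : Karoubi C) (hP : IsSimpleMor P.p) (x : End P) :
    IsUnit x ∨ x = 0 := by
  refine or_iff_not_imp_right.2 fun hx => ?_
  have hne : (𝟙 P : P ⟶ P) ≠ 0 := fun h => hP.1 (Karoubi.hom_eq_zero_iff.1 h)
  obtain ⟨y, hy⟩ := exists_comp_eq_id_of_isSimpleMor P hP x hx
  -- The one-sided inverse `y` is nonzero and so has one itself, which must equal `x`.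
  obtain ⟨z, hz⟩ := exists_comp_eq_id_of_isSimpleMor P hP y (by
    rintro rfl
    exact hne (by rw [← hy, zero_comp]))
  have hzx : z = x := by
    rw [← Category.comp_id z, ← hy, ← Category.assoc, hz, Category.id_comp]
  subst hzx
  exact ⟨⟨z, y, hy, hz⟩, rfl⟩

/-- The endomorphism ring of the object cut out by a simple idempotent is a division ring. -/
abbrev divisionRingEnd (P : Karoubi C) (hP : IsSimpleMor P.p) : DivisionRing (End P) :=
  haveI : Nontrivial (End P) :=
    ⟨1, 0, fun h => hP.1 (Karoubi.hom_eq_zero_iff.1 h)⟩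
  DivisionRing.ofIsUnitOrEqZero (isUnit_or_eq_zero_of_isSimpleMor P hP)

end SimpleMorphisms

/-! ### Full faithfulness of `Hom(P,-)` on summands of powers of `P`. -/

section Progenerator

variable {K : Type u} [Category.{v} K] [Preadditive K]

/-- `X` is a direct summand of a finite power of `P`, expressed without biproducts. -/
def IsSummandOfPower (P X : K) : Prop :=
  ∃ (ι : Type) (_ : Fintype ι) (a : ι → (X ⟶ P)) (b : ι → (P ⟶ X)), 𝟙 X = ∑ i, a i ≫ b i

variable {P X Y : K}

/-- A dual basis: the `b i` generate the right `End P`-module `Hom(P,X)`, with coordinates given by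
composition with the `a i`. -/
theorem eq_sum_smul {ι : Type} [Fintype ι] {a : ι → (X ⟶ P)} {b : ι → (P ⟶ X)}
    (h : 𝟙 X = ∑ i, a i ≫ b i) (v : P ⟶ X) :
    v = ∑ i, (MulOpposite.op (v ≫ a i) : (End P)ᵐᵒᵖ) • b i :=
  calc v = v ≫ 𝟙 X := (Category.comp_id v).symm
    _ = ∑ i, v ≫ a i ≫ b i := by rw [h, Preadditive.comp_sum]
    _ = _ := Finset.sum_congr rfl fun i _ => (Category.assoc _ _ _).symm

theorem IsSummandOfPower.finite (h : IsSummandOfPower P X) :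
    Module.Finite (End P)ᵐᵒᵖ (P ⟶ X) := by
  classical
  obtain ⟨ι, _, a, b, h⟩ := h
  refine ⟨⟨Finset.univ.image b, ?_⟩⟩
  rw [eq_top_iff]
  intro v _
  rw [eq_sum_smul h v]
  exact Submodule.sum_mem _ fun i _ => Submodule.smul_mem _ _ (Submodule.subset_span (by simp))

theorem IsSummandOfPower.map_injective (h : IsSummandOfPower P X) :
    Function.Injective
      (fun f : X ⟶ Y => (preadditiveCoyonedaObj P).map f) := by
  obtain ⟨ι, _, a, b, h⟩ := h
  intro f g hfg
  have hb : ∀ v : P ⟶ X, v ≫ f = v ≫ g := fun v =>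
    congrArg (fun t : (preadditiveCoyonedaObj P).obj X ⟶ (preadditiveCoyonedaObj P).obj Y =>
      t.hom v) hfg
  rw [← Category.id_comp f, ← Category.id_comp g, h, Preadditive.sum_comp, Preadditive.sum_comp]
  exact Finset.sum_congr rfl fun i _ => by rw [Category.assoc, Category.assoc, hb]

theorem IsSummandOfPower.map_surjective (h : IsSummandOfPower P X) :
    Function.Surjective
      (fun f : X ⟶ Y => (preadditiveCoyonedaObj P).map f) := by
  obtain ⟨ι, _, a, b, h⟩ := h
  intro t
  let τ : (P ⟶ X) →ₗ[(End P)ᵐᵒᵖ] (P ⟶ Y) := t.hom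
  -- Linearity makes `τ` determined by its values on the generators `b i`, and the `a i` supply the
  -- coordinates.
  refine ⟨∑ i, a i ≫ τ (b i), ?_⟩
  ext v
  change P ⟶ X at v
  change v ≫ ∑ i, a i ≫ τ (b i) = τ v
  conv_rhs => rw [eq_sum_smul h v, map_sum]
  rw [Preadditive.comp_sum]
  refine Finset.sum_congr rfl fun i _ => ?_
  rw [map_smul]
  exact (Category.assoc _ _ _).symm

end Progenerator

/-! ### Realisation as a full subcategory of finitely generated modules. -/

section FullSubcategories

variable {C : Type u} [Category.{v} C] [Preadditive C]

/-- A copy of the modules `V A` whose underlying sets are disjoint subsets of `Σ A, V A`. -/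
def sigmaFGMod {R : Type v} [Ring R] (V : C → ModuleCat.{v} Rᵐᵒᵖ)
    [∀ A, Module.Finite Rᵐᵒᵖ (V A)] (A : C) : FGModIn R (Σ A, V A) :=
  letI e : {x : Σ A, V A | x.1 = A} ≃ V A := Equiv.sigmaSubtype A
  letI : AddCommGroup {x : Σ A, V A | x.1 = A} := e.addCommGroup
  letI : Module Rᵐᵒᵖ {x : Σ A, V A | x.1 = A} := e.module Rᵐᵒᵖ
  { carrier := {x : Σ A, V A | x.1 = A}
    finite := Module.Finite.equiv (e.linearEquiv Rᵐᵒᵖ).symm }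

/-- The copy of `V A` is isomorphic to `V A`. -/
def sigmaFGModEquiv {R : Type v} [Ring R] (V : C → ModuleCat.{v} Rᵐᵒᵖ)
    [∀ A, Module.Finite Rᵐᵒᵖ (V A)] (A : C) : (sigmaFGMod V A).carrier ≃ₗ[Rᵐᵒᵖ] V A :=
  letI e : {x : Σ A, V A | x.1 = A} ≃ V A := Equiv.sigmaSubtype A
  e.linearEquiv Rᵐᵒᵖ

-- Each fibre contains the zero vector, so even zero modules have nonempty, hence distinct,
-- carriers. This keeps distinct objects with isomorphic modules apart, as an isomorphism of
-- categories requires.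
omit [Category.{v} C] [Preadditive C] in
theorem sigmaFGMod_injective {R : Type v} [Ring R] (V : C → ModuleCat.{v} Rᵐᵒᵖ)
    [∀ A, Module.Finite Rᵐᵒᵖ (V A)] : Function.Injective (sigmaFGMod V) := by
  intro A B h
  have hc : {x : Σ A, V A | x.1 = A} = {x : Σ A, V A | x.1 = B} :=
    congrArg FGModIn.carrier h
  have hmem : (⟨A, 0⟩ : Σ A, V A) ∈ {x : Σ A, V A | x.1 = A} := rfl
  rw [hc] at hmem
  exact hmem

/-- A fully faithful additive functor to finitely generated modules identifies its source with a
full subcategory, after replacing the modules by disjoint copies. -/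
theorem isoToFullSubcatFGMod_of_functor {R : Type v} [Ring R] (F : C ⥤ ModuleCat.{v} Rᵐᵒᵖ)
    [F.Additive] [F.Full] [F.Faithful] [∀ A, Module.Finite Rᵐᵒᵖ (F.obj A)] :
    IsoToFullSubcatFGMod C R := by
  let e := sigmaFGModEquiv F.obj
  let G : C ⥤ FullSubcatOn (Set.range (sigmaFGMod F.obj)) :=
    { obj := fun A => ⟨sigmaFGMod F.obj A, A, rfl⟩
      map := fun {A B} f => InducedCategory.homMk
        (ModuleCat.ofHom ((e B).symm.toLinearMap ∘ₗ (F.map f).hom ∘ₗ (e A).toLinearMap))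
      map_id := fun A => by
        ext x
        change (e A).symm ((F.map (𝟙 A)).hom (e A x)) = x
        rw [F.map_id]
        exact (e A).symm_apply_apply x
      map_comp := fun {A B D} f g => by
        ext x
        change (e D).symm ((F.map (f ≫ g)).hom (e A x)) =
          (e D).symm ((F.map g).hom (e B ((e B).symm ((F.map f).hom (e A x)))))
        simp }
  refine ⟨_, Set.range (sigmaFGMod F.obj), G, ⟨?_⟩, ⟨?_⟩, ⟨?_⟩, ?_, ?_⟩
  · intro A B f g
    ext x
    change (e B).symm ((F.map (f + g)).hom (e A x)) =
      (e B).symm ((F.map f).hom (e A x)) + (e B).symm ((F.map g).hom (e A x))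
    rw [F.map_add, ModuleCat.hom_add, LinearMap.add_apply, map_add]
  · intro A B t
    let τ : (sigmaFGMod F.obj A).carrier →ₗ[Rᵐᵒᵖ] (sigmaFGMod F.obj B).carrier := t.hom.hom
    obtain ⟨f, hf⟩ := F.map_surjective
      (ModuleCat.ofHom ((e B).toLinearMap ∘ₗ τ ∘ₗ (e A).symm.toLinearMap))
    refine ⟨f, ?_⟩
    ext x
    change (e B).symm ((F.map f).hom (e A x)) = τ x
    rw [hf]
    change (e B).symm (e B (τ ((e A).symm (e A x)))) = τ x
    rw [LinearEquiv.symm_apply_apply]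
    exact congrArg τ ((e A).symm_apply_apply x)
  · intro A B f g hfg
    apply F.map_injective
    ext x
    have : (e B).symm ((F.map f).hom (e A ((e A).symm x))) =
        (e B).symm ((F.map g).hom (e A ((e A).symm x))) :=
      congrArg (fun t : G.obj A ⟶ G.obj B =>
        (t.hom.hom : (sigmaFGMod F.obj A).carrier → (sigmaFGMod F.obj B).carrier)
          ((e A).symm x)) hfg
    simpa using this
  · intro A B h
    exact sigmaFGMod_injective F.obj (congrArg Subtype.val h)
  · rintro ⟨_, A, rfl⟩
    exact ⟨A, rfl⟩

open Idempotents

/-- A simple category with a minimal right ideal is a full subcategory of the category of finite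
dimensional vector spaces over a division ring. -/
theorem IsSimpleMor.exists_divisionRing (hC : SimpleCategory C) {B A : C} {s : B ⟶ A}
    (hs : IsSimpleMor s) :
    ∃ (D : Type v) (_ : DivisionRing D), IsoToFullSubcatFGMod C D := by
  obtain ⟨e, he, hes⟩ := hs.exists_idempotent hC
  let P : Karoubi C := ⟨A, e, he⟩
  have hP (Y : C) : IsSummandOfPower P ((toKaroubi C).obj Y) := by
    obtain ⟨ι, _, a, b, h⟩ := hC.exists_sum hes.1 (𝟙 Y)
    -- The factor `e` in `a i ≫ e ≫ b i` is split as `e ≫ e`, so that both halves become morphisms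
    -- to and from `P`.
    refine ⟨ι, inferInstance, fun i => ⟨a i ≫ e, by simp [P, he]⟩,
      fun i => ⟨e ≫ b i, by simp [P, reassoc_of% he]⟩, ?_⟩
    ext
    simp [h, reassoc_of% he]
  let F : C ⥤ ModuleCat.{v} (End P)ᵐᵒᵖ := toKaroubi C ⋙ preadditiveCoyonedaObj P
  have : F.Full := ⟨fun {X Y} t => by
    obtain ⟨f, hf⟩ := (hP X).map_surjective t
    exact ⟨f.f, hf⟩⟩
  have : F.Faithful := ⟨fun {X Y} f g h =>
    (toKaroubi C).map_injective ((hP X).map_injective h)⟩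
  have (Y : C) : Module.Finite (End P)ᵐᵒᵖ (F.obj Y) := (hP Y).finite
  exact ⟨End P, divisionRingEnd P hes, isoToFullSubcatFGMod_of_functor F⟩

end FullSubcategories

/-! ### Modules over a simple artinian ring and matrices. -/

section MatrixDescription

variable {R : Type*} [Ring R] {S M N : Type*} [AddCommGroup S] [Module R S] [AddCommGroup M]
  [Module R M] [AddCommGroup N] [Module R N] {m n : ℕ}

/-- Linear maps between powers of a module `S` are matrices over the endomorphism ring of `S`. -/
def linearMapEquivMatrixEnd (eM : M ≃ₗ[R] Fin m → S) (eN : N ≃ₗ[R] Fin n → S) :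
    (M →ₗ[R] N) ≃+ Matrix (Fin n) (Fin m) (Module.End R S) where
  toFun f := Matrix.of fun i j =>
    LinearMap.proj i ∘ₗ eN.toLinearMap ∘ₗ f ∘ₗ eM.symm.toLinearMap ∘ₗ LinearMap.single R (fun _ => S) j
  invFun T := eN.symm.toLinearMap ∘ₗ
    (LinearMap.pi fun i => ∑ j, T i j ∘ₗ LinearMap.proj j) ∘ₗ eM.toLinearMap
  left_inv f := by
    ext x
    apply eN.injective
    ext i
    simp only [LinearMap.comp_apply, LinearEquiv.coe_coe, LinearEquiv.apply_symm_apply,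
      LinearMap.pi_apply, LinearMap.sum_apply, Matrix.of_apply, LinearMap.proj_apply]
    rw [← Finset.sum_apply, ← map_sum, ← map_sum, ← map_sum]
    simp only [LinearMap.coe_single]
    rw [Finset.univ_sum_single, eM.symm_apply_apply]
  right_inv T := by
    ext i j x
    simp [Pi.single_apply, apply_ite]
  map_add' f g := by
    ext i j x
    simp

theorem linearMapEquivMatrixEnd_comp {L : Type*} [AddCommGroup L] [Module R L] {l : ℕ}
    (eL : L ≃ₗ[R] Fin l → S) (eM : M ≃ₗ[R] Fin m → S) (eN : N ≃ₗ[R] Fin n → S)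
    (f : M →ₗ[R] N) (g : L →ₗ[R] M) :
    linearMapEquivMatrixEnd eL eN (f ∘ₗ g) =
      linearMapEquivMatrixEnd eM eN f * linearMapEquivMatrixEnd eL eM g := by
  obtain ⟨T, rfl⟩ := (linearMapEquivMatrixEnd eM eN).symm.surjective f
  ext i j x
  rw [AddEquiv.apply_symm_apply, Matrix.mul_apply]
  simp [linearMapEquivMatrixEnd]

/-- Finitely generated modules over a simple artinian ring are powers of a simple module. -/
theorem exists_linearEquiv_fun_of_isSimpleRing (R : Type v) [Ring R] [IsSimpleRing R]
    [IsArtinianRing R] : ∃ (S : Type v) (_ : AddCommGroup S) (_ : Module R S),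
      IsSimpleModule R S ∧ ∀ (M : Type (max u v)) [AddCommGroup M] [Module R M]
        [Module.Finite R M], ∃ n : ℕ, Nonempty (M ≃ₗ[R] Fin n → S) := by
  obtain ⟨S, hS⟩ := IsAtomic.exists_atom (Ideal R)
  rw [← isSimpleModule_iff_isAtom] at hS
  refine ⟨S, inferInstance, inferInstance, hS, fun M _ _ _ => ?_⟩
  -- Every simple submodule of `M` is isomorphic to a left ideal, and all minimal left ideals of a
  -- simple artinian ring are isomorphic.
  have h : IsIsotypicOfType R M S := fun m _ => by
    obtain ⟨I, ⟨e⟩⟩ := IsSemisimpleRing.exists_linearEquiv_ideal_of_isSimpleModule R m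
    have := IsSimpleModule.congr e.symm
    exact ⟨e.trans (IsSimpleRing.isIsotypic R R S I).some⟩
  exact h.linearEquiv_fun

/-- The matrix description of a full subcategory of the finitely generated modules over a simple
artinian ring. -/
theorem exists_matrix_of_isoToFullSubcatFGMod {C : Type u} [Category.{v} C] [Preadditive C]
    {R : Type v} [Ring R] [IsSimpleRing R] [IsArtinianRing R] (h : IsoToFullSubcatFGMod C R) :
    ∃ (D : Type v) (_ : DivisionRing D) (n : C → ℕ)
      (φ : ∀ A B : C, (A ⟶ B) ≃+ Matrix (Fin (n B)) (Fin (n A)) D),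
      ∀ (A X B : C) (g : A ⟶ X) (f : X ⟶ B), φ A B (g ≫ f) = φ X B f * φ A X g := by
  classical
  -- The artinian condition is one-sided; semisimplicity is symmetric and carries it to `Rᵐᵒᵖ`, over
  -- which right modules live.
  have : IsSemisimpleRing R := inferInstance
  have : IsArtinianRing Rᵐᵒᵖ := inferInstance
  obtain ⟨Ω, P, F, _, _, _, -⟩ := h
  obtain ⟨S, _, _, _, hS⟩ := exists_linearEquiv_fun_of_isSimpleRing.{v, u} Rᵐᵒᵖ
  choose n e using fun A : C => hS (F.obj A).1.carrier
  let e' (A : C) := (e A).some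
  let ψ (A B : C) : (A ⟶ B) ≃+
      ((F.obj A).1.carrier →ₗ[Rᵐᵒᵖ] (F.obj B).1.carrier) :=
    AddEquiv.ofBijective (AddMonoidHom.mk' (fun f => (F.map f).hom.hom) fun f g => by
      rw [F.map_add]; rfl) (by
      constructor
      · intro f g hfg
        apply F.map_injective
        ext1
        exact ModuleCat.hom_ext hfg
      · intro t
        obtain ⟨f, hf⟩ := F.map_surjective (X := A) (Y := B)
          (InducedCategory.homMk (ModuleCat.ofHom t))
        refine ⟨f, ?_⟩
        change (F.map f).hom.hom = t
        rw [hf]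
        rfl)
  -- The endomorphism ring of the simple module `S` is a division ring by Schur's lemma.
  refine ⟨Module.End Rᵐᵒᵖ S, inferInstance, n,
    fun A B => (ψ A B).trans (linearMapEquivMatrixEnd (e' A) (e' B)), fun A X B g f => ?_⟩
  have hcomp : ψ A B (g ≫ f) = ψ X B f ∘ₗ ψ A X g := by
    change (F.map (g ≫ f)).hom.hom = _
    rw [F.map_comp]
    rfl
  simp only [AddEquiv.trans_apply]
  rw [hcomp, linearMapEquivMatrixEnd_comp (e' A) (e' X) (e' B)]

end MatrixDescription

/-! ### Simplicity and the chain condition from matrices. -/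

section MatrixPresentation

variable (C : Type u) [Category.{v} C] [Preadditive C]

/-- Compatible descriptions of the morphism groups of `C` by matrices over `D`. -/
structure MatrixPresentation (D : Type v) [DivisionRing D] where
  /-- the size of an object -/
  size : C → ℕ
  /-- the matrix of a morphism -/
  toMatrix : ∀ A B : C, (A ⟶ B) ≃+ Matrix (Fin (size B)) (Fin (size A)) D
  toMatrix_comp : ∀ {A X B : C} (g : A ⟶ X) (f : X ⟶ B),
    toMatrix A B (g ≫ f) = toMatrix X B f * toMatrix A X g

variable {C}

/-- A right ideal of `C`: an additive subfunctor of `C(-,A)`. -/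
@[ext]
structure RightIdeal (A : C) where
  /-- the subgroup of the morphisms with source `B` -/
  carrier : ∀ B : C, AddSubgroup (B ⟶ A)
  comp_mem : ∀ {B' B : C} (f : B' ⟶ B) (m : B ⟶ A), m ∈ carrier B → f ≫ m ∈ carrier B'

instance (A : C) : PartialOrder (RightIdeal A) :=
  PartialOrder.lift RightIdeal.carrier fun _ _ => RightIdeal.ext

namespace MatrixPresentation

variable {D : Type v} [DivisionRing D] (W : MatrixPresentation C D)

/-- The morphism with a given matrix. -/
def mor {A B : C} : Matrix (Fin (W.size B)) (Fin (W.size A)) D ≃+ (A ⟶ B) :=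
  (W.toMatrix A B).symm

@[simp]
theorem toMatrix_mor {A B : C} (M : Matrix (Fin (W.size B)) (Fin (W.size A)) D) :
    W.toMatrix A B (W.mor M) = M :=
  (W.toMatrix A B).apply_symm_apply M

@[simp]
theorem mor_toMatrix {A B : C} f : W.mor (W.toMatrix A B f) = f :=
  (W.toMatrix A B).symm_apply_apply f

/-- Units are not assumed to be preserved; it follows since the unit matrix is itself the matrix of
a morphism. -/
theorem toMatrix_id (A : C) : W.toMatrix A A (𝟙 A) = 1 := by
  have h := W.toMatrix_comp (W.mor (1 : Matrix (Fin (W.size A)) (Fin (W.size A)) D)) (𝟙 A)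
  rwa [Category.comp_id, toMatrix_mor, mul_one, eq_comm] at h

theorem mor_comp_mor {A X B : C} (M : Matrix (Fin (W.size X)) (Fin (W.size A)) D)
    (N : Matrix (Fin (W.size B)) (Fin (W.size X)) D) :
    W.mor M ≫ W.mor N = W.mor (N * M) := by
  apply (W.toMatrix A B).injective
  rw [toMatrix_comp, toMatrix_mor, toMatrix_mor, toMatrix_mor]

theorem size_pos {A : C} (hA : 𝟙 A ≠ 0) : 0 < W.size A := by
  refine Nat.pos_of_ne_zero fun h => hA ((W.toMatrix A A).injective ?_)
  ext i
  exact (Fin.cast h i).elim0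

include W in
theorem simpleCategory (hC : ∃ A : C, 𝟙 A ≠ 0) : SimpleCategory C := by
  obtain ⟨A₀, hA₀⟩ := hC
  refine ⟨⟨A₀, A₀, 𝟙 A₀, hA₀⟩, fun I => or_iff_not_imp_left.2 fun hI => ?_⟩
  push Not at hI
  obtain ⟨A, B, hAB⟩ := hI
  obtain ⟨f, hf, hf0⟩ : ∃ f ∈ I.carrier A B, f ≠ 0 := by
    by_contra! h
    exact hAB ((AddSubgroup.eq_bot_iff_forall _).2 h)
  obtain ⟨i, j, hij⟩ : ∃ i j, W.toMatrix A B f i j ≠ 0 := by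
    by_contra! h
    exact hf0 ((W.toMatrix A B).injective (by ext i j; simpa using h i j))
  intro X Y
  rw [eq_top_iff]
  intro g _
  rw [← W.mor_toMatrix g, Matrix.matrix_eq_sum_single (W.toMatrix X Y g), map_sum]
  refine sum_mem fun k _ => ?_
  rw [map_sum]
  refine sum_mem fun l _ => ?_
  -- With `F` the matrix of `f`, the product `E_{ki}(c F_{ij}⁻¹) · F · E_{jl}` is `c E_{kl}`: one
  -- nonzero entry produces every elementary matrix of every size.
  have h := I.comp_mem (W.mor (Matrix.single j l 1)) f
    (W.mor (Matrix.single k i (W.toMatrix X Y g k l * (W.toMatrix A B f i j)⁻¹))) hf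
  rw [← W.mor_toMatrix f, mor_comp_mor, mor_comp_mor] at h
  convert h using 2
  rw [Matrix.single_mul_mul_single, mul_one, mor_toMatrix, inv_mul_cancel_right₀ hij]

section RightIdeals

variable {A₀ : C} (i₀ : Fin (W.size A₀))

/-- The matrix with column `w` in position `i₀`. -/
def colMatrix {m k : ℕ} (i₀ : Fin m) : (Fin k → D) →+ Matrix (Fin k) (Fin m) D where
  toFun w := Matrix.of fun k l => if l = i₀ then w k else 0
  map_zero' := by ext; simp
  map_add' v w := by
    ext k l
    by_cases h : l = i₀ <;> simp [h]

theorem mul_single_eq_colMatrix {m k l : ℕ} (i₀ : Fin m) (M : Matrix (Fin k) (Fin l) D)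
    (j : Fin l) : M * Matrix.single j i₀ (1 : D) = colMatrix i₀ (fun i => M i j) := by
  ext a b
  by_cases h : b = i₀
  · subst h; simp [colMatrix]
  · simp [colMatrix, h]

theorem colMatrix_mul_single {m k l : ℕ} (i₀ : Fin m) (w : Fin k → D) (j : Fin l) (d : D) :
    colMatrix i₀ w * Matrix.single i₀ j d = colMatrix j (fun i => w i * d) := by
  ext a b
  by_cases h : b = j
  · subst h; simp [colMatrix]
  · simp [colMatrix, h]

theorem sum_colMatrix {k l : ℕ} (M : Matrix (Fin k) (Fin l) D) :
    ∑ j, colMatrix j (fun i => M i j) = M := by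
  ext a b
  simp [colMatrix, Matrix.sum_apply]

/-- The subspace of the column space corresponding to a right ideal. -/
def columns {A : C} (I : RightIdeal A) : Submodule Dᵐᵒᵖ (Fin (W.size A) → D) where
  carrier := {w | W.mor (colMatrix i₀ w) ∈ I.carrier A₀}
  zero_mem' := by simp
  add_mem' {v w} hv hw := by
    simp only [Set.mem_ofPred_eq, map_add] at *
    exact add_mem hv hw
  smul_mem' d w hw := by
    have h := I.comp_mem (W.mor (Matrix.single i₀ i₀ d.unop)) _ hw
    rwa [mor_comp_mor, colMatrix_mul_single] at h

/-- Right multiplication by `E_{j i₀}` moves column `j` to position `i₀` over `A₀`, and `E_{i₀ j}`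
moves it back; a matrix is the sum of its columns. So a right ideal is determined by one space of
columns. -/
theorem mem_iff_columns {A B : C} (I : RightIdeal A) (f : B ⟶ A) :
    f ∈ I.carrier B ↔ ∀ j, (fun i => W.toMatrix B A f i j) ∈ W.columns i₀ I := by
  constructor
  · intro hf j
    have h := I.comp_mem (W.mor (Matrix.single j i₀ 1) : A₀ ⟶ B) f hf
    rwa [← W.mor_toMatrix f, mor_comp_mor, mul_single_eq_colMatrix] at h
  · intro h
    rw [← W.mor_toMatrix f, ← sum_colMatrix (W.toMatrix B A f), map_sum]
    refine sum_mem fun j _ => ?_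
    have hj := I.comp_mem (W.mor (Matrix.single i₀ j 1) : B ⟶ A₀) _ (h j)
    rw [mor_comp_mor, colMatrix_mul_single] at hj
    simpa using hj

theorem columns_injective (A : C) :
    Function.Injective (W.columns i₀ : RightIdeal A → _) := by
  intro I J h
  ext B f
  rw [W.mem_iff_columns i₀, W.mem_iff_columns i₀, h]

theorem columns_mono (A : C) : Monotone (W.columns i₀ : RightIdeal A → _) :=
  fun _ _ h _ hw => h A₀ hw

end RightIdeals

include W in
/-- Right ideals satisfy the descending chain condition. -/
theorem rightIdeal_chain_condition (hC : ∃ A : C, 𝟙 A ≠ 0) {A : C} (N : ℕ → RightIdeal A)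
    (hN : Antitone N) : ∃ m, ∀ i, m ≤ i → N m = N i := by
  obtain ⟨A₀, hA₀⟩ := hC
  let i₀ : Fin (W.size A₀) := ⟨0, W.size_pos hA₀⟩
  -- Column spaces are right vector spaces, and `D` is spanned by `1` on the right.
  have : Module.Finite Dᵐᵒᵖ D := ⟨⟨{1}, by
    rw [eq_top_iff]
    intro d _
    have h := Submodule.smul_mem (Submodule.span Dᵐᵒᵖ ((({1} : Finset D) : Set D)))
      (MulOpposite.op d) (Submodule.subset_span (Finset.mem_coe.2 (Finset.mem_singleton_self 1)))
    simpa using h⟩⟩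
  have : IsArtinian Dᵐᵒᵖ (Fin (W.size A) → D) := inferInstance
  obtain ⟨m, hm⟩ := IsArtinian.monotone_stabilizes
    (⟨fun i => OrderDual.toDual (W.columns i₀ (N i)), fun i j hij => W.columns_mono i₀ A (hN hij)⟩ :
      ℕ →o (Submodule Dᵐᵒᵖ (Fin (W.size A) → D))ᵒᵈ)
  exact ⟨m, fun i hi => W.columns_injective i₀ A (hm i hi)⟩

end MatrixPresentation

end MatrixPresentation

/-! ### Ideals of `C` and graded ideals of `R[C]`. -/

section GradedIdeals

variable {C : Type u} [Category.{v} C] [Preadditive C]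

namespace CatRing

theorem coeff_of_self (p : C × C) (f : p.2 ⟶ p.1) : coeff p (of p f) = f := by
  classical
  exact DirectSum.of_eq_same (β := fun p : C × C => (p.2 ⟶ p.1)) p f

theorem coeff_of_ne {p q : C × C} (h : p ≠ q) (f : q.2 ⟶ q.1) : coeff p (of q f) = 0 := by
  classical
  exact DirectSum.of_eq_of_ne (β := fun p : C × C => (p.2 ⟶ p.1)) _ _ f h

theorem ext_coeff {x y : CatRing C} (h : ∀ p, coeff p x = coeff p y) : x = y :=
  DFinsupp.ext h

theorem exists_eq_sum_of (x : CatRing C) :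
    ∃ s : Finset (C × C), x = ∑ p ∈ s, of p (coeff p x) := by
  classical
  exact ⟨DFinsupp.support x, (DirectSum.sum_support_of x).symm⟩

theorem mem_of_coeff_mem {N : AddSubgroup (CatRing C)} {x : CatRing C}
    (h : ∀ p, of p (coeff p x) ∈ N) : x ∈ N := by
  obtain ⟨s, hs⟩ := exists_eq_sum_of x
  rw [hs]
  exact sum_mem fun p _ => h p

/-- The graded subgroup with given homogeneous components. -/
def gradedSubgroup (J : ∀ p : C × C, AddSubgroup (p.2 ⟶ p.1)) : AddSubgroup (CatRing C) where
  carrier := {x | ∀ p, coeff p x ∈ J p}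
  zero_mem' p := by
    rw [map_zero]
    exact zero_mem _
  add_mem' hx hy p := by
    rw [map_add]
    exact add_mem (hx p) (hy p)
  neg_mem' hx p := by
    rw [map_neg]
    exact neg_mem (hx p)

variable {J : ∀ p : C × C, AddSubgroup (p.2 ⟶ p.1)}

theorem of_mem_gradedSubgroup {p : C × C} {f : p.2 ⟶ p.1} :
    of p f ∈ gradedSubgroup J ↔ f ∈ J p := by
  refine ⟨fun h => by simpa only [coeff_of_self] using h p, fun hf q => ?_⟩
  by_cases h : q = p
  · subst h
    rwa [coeff_of_self]
  · rw [coeff_of_ne h]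
    exact zero_mem _

theorem isGraded_gradedSubgroup : IsGraded (gradedSubgroup J) :=
  fun _ hx p => of_mem_gradedSubgroup.2 (hx p)

theorem gradedSubgroup_mul_mem
    (hJ : ∀ {A B B' : C} (f : B ⟶ A) (g : B' ⟶ B), f ∈ J (A, B) → g ≫ f ∈ J (A, B'))
    (x : CatRing C) (hx : x ∈ gradedSubgroup J) (r : CatRing C) : x * r ∈ gradedSubgroup J := by
  obtain ⟨s, hs⟩ := exists_eq_sum_of x
  obtain ⟨t, ht⟩ := exists_eq_sum_of r
  rw [hs, ht, Finset.sum_mul_sum]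
  refine sum_mem fun p _ => sum_mem fun q _ => ?_
  have hp := hx p
  generalize coeff p x = f at hp
  generalize coeff q r = g
  obtain ⟨A, B⟩ := p
  obtain ⟨B', X⟩ := q
  by_cases h : B' = B
  · subst h
    rw [of_mul_of_comp]
    exact of_mem_gradedSubgroup.2 (hJ f g hp)
  · rw [of_mul_of_ne (p := (A, B)) (q := (B', X)) h]
    exact zero_mem _

theorem mul_gradedSubgroup_mem
    (hJ : ∀ {A A' B : C} (f : B ⟶ A) (g : A ⟶ A'), f ∈ J (A, B) → f ≫ g ∈ J (A', B))
    (x : CatRing C) (hx : x ∈ gradedSubgroup J) (r : CatRing C) : r * x ∈ gradedSubgroup J := by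
  obtain ⟨s, hs⟩ := exists_eq_sum_of x
  obtain ⟨t, ht⟩ := exists_eq_sum_of r
  rw [hs, ht, Finset.sum_mul_sum]
  refine sum_mem fun q _ => sum_mem fun p _ => ?_
  have hp := hx p
  generalize coeff p x = f at hp
  generalize coeff q r = g
  obtain ⟨A, B⟩ := p
  obtain ⟨X, A'⟩ := q
  by_cases h : A = A'
  · subst h
    rw [of_mul_of_comp]
    exact of_mem_gradedSubgroup.2 (hJ f g hp)
  · rw [of_mul_of_ne (p := (X, A')) (q := (A, B)) h]
    exact zero_mem _

end CatRing

open CatRing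

/-- A graded ideal of `R[C]` gives an ideal of `C`. -/
def CatRing.IsGradedIdeal.catIdeal {N : AddSubgroup (CatRing C)} (hN : IsGradedIdeal N) :
    CatIdeal C where
  carrier A B := N.comap (of (B, A))
  comp_mem {A' A B B'} f m g hm := by
    have h := hN.mul_mem_left _ (hN.mul_mem _ hm (of (A, A') f)) (of (B', B) g)
    rw [of_mul_of_comp, of_mul_of_comp, Category.assoc] at h
    exact h

theorem SimpleCategory.grSimpleCatRing (hC : SimpleCategory C) : GrSimpleCatRing C := by
  obtain ⟨⟨A, B, f, hf⟩, hI⟩ := hC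
  refine ⟨⟨of (B, A) f, 0, fun h => hf ?_⟩, fun N hN => ?_⟩
  · rw [← coeff_of_self (B, A) f, h, map_zero]
  · refine (hI hN.catIdeal).imp (fun h => ?_) fun h => ?_
    · refine (AddSubgroup.eq_bot_iff_forall _).2 fun x hx => ext_coeff fun p => ?_
      have hp : coeff p x ∈ hN.catIdeal.carrier p.2 p.1 := hN.graded x hx p
      rw [h] at hp
      rw [AddSubgroup.mem_bot.1 hp, map_zero]
    · refine eq_top_iff.2 fun x _ => mem_of_coeff_mem fun p => ?_
      have hp : coeff p x ∈ hN.catIdeal.carrier p.2 p.1 := by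
        rw [h]
        trivial
      exact hp

theorem GrSimpleCatRing.simpleCategory (hC : GrSimpleCatRing C) : SimpleCategory C := by
  obtain ⟨hnt, hN⟩ := hC
  refine ⟨?_, fun I => ?_⟩
  · by_contra! h
    obtain ⟨x, hx⟩ := exists_ne (0 : CatRing C)
    exact hx (ext_coeff fun p => by rw [h _ _ (coeff p x), map_zero])
  · refine (hN (gradedSubgroup fun p => I.carrier p.2 p.1)
      ⟨gradedSubgroup_mul_mem fun f g hf => ?_, mul_gradedSubgroup_mem fun f g hf => ?_,
        isGraded_gradedSubgroup⟩).imp (fun h A B => ?_) (fun h A B => ?_)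
    · simpa using I.comp_mem g f (𝟙 _) hf
    · simpa using I.comp_mem (𝟙 _) f g hf
    · refine (AddSubgroup.eq_bot_iff_forall _).2 fun f hf => ?_
      have hmem := (of_mem_gradedSubgroup (J := fun p => I.carrier p.2 p.1) (p := (B, A))).2 hf
      rw [h] at hmem
      rw [← coeff_of_self (B, A) f, AddSubgroup.mem_bot.1 hmem, map_zero]
    · refine eq_top_iff.2 fun f _ => ?_
      apply (of_mem_gradedSubgroup (J := fun p => I.carrier p.2 p.1) (p := (B, A))).1
      rw [h]
      trivial

/-- A graded right ideal inside row `A` is recovered from its components of degrees `(A, B)`, which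
form a right ideal of the category. -/
theorem MatrixPresentation.artinianCatRing {D : Type v} [DivisionRing D]
    (W : MatrixPresentation C D) (hC : ∃ A : C, 𝟙 A ≠ 0) : ArtinianCatRing C := by
  intro A N hN hI hA
  obtain ⟨m, hm⟩ := W.rightIdeal_chain_condition hC (A := A)
    (fun i => ⟨fun B => (N i).comap (of (A, B)), fun {B' B} f x hx => by
      have h := (hI i).mul_mem _ hx (of (B, B') f)
      rw [of_mul_of_comp] at h
      exact h⟩)
    (fun i j hij B f hf => hN hij hf)
  refine ⟨m, fun i hi => le_antisymm (hN hi) fun x hx => mem_of_coeff_mem fun p => ?_⟩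
  obtain ⟨A', B⟩ := p
  by_cases h : A' = A
  · subst h
    have hc := congrArg (fun J : RightIdeal A' => J.carrier B) (hm i hi)
    have hx' : coeff (A', B) x ∈ (N m).comap (of (A', B)) := (hI m).graded x hx _
    rw [show (N m).comap (of (A', B)) = (N i).comap (of (A', B)) from hc] at hx'
    exact hx'
  · rw [hA m hx (A', B) h, map_zero]
    exact zero_mem _

/-- The right ideal generated by a morphism, as a graded right ideal of `R[C]`. -/
def principalRightIdeal {A B : C} (s : B ⟶ A) : AddSubgroup (CatRing C) :=
  gradedSubgroup fun p =>
    -- Outside row `A` the first set is empty, so `{0}` is needed to have a subgroup there.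
    { carrier := {f | ∃ (h : p.1 = A) (g : p.2 ⟶ B), f = g ≫ s ≫ eqToHom h.symm} ∪ {0}
      zero_mem' := Or.inr rfl
      add_mem' := by
        rintro _ _ (⟨h, g, rfl⟩ | rfl) (⟨h', g', rfl⟩ | rfl)
        · exact Or.inl ⟨h, g + g', by simp⟩
        · exact Or.inl ⟨h, g, by simp⟩
        · exact Or.inl ⟨h', g', by simp⟩
        · exact Or.inr (by simp)
      neg_mem' := by
        rintro _ (⟨h, g, rfl⟩ | rfl)
        · exact Or.inl ⟨h, -g, by simp⟩
        · exact Or.inr (by simp) }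

theorem isGradedRightIdeal_principalRightIdeal {A B : C} (s : B ⟶ A) :
    IsGradedRightIdeal (principalRightIdeal s) := by
  refine ⟨gradedSubgroup_mul_mem fun f g hf => ?_, isGraded_gradedSubgroup⟩
  rcases hf with ⟨h, k, rfl⟩ | hf
  · exact Or.inl ⟨h, g ≫ k, by simp⟩
  · rw [Set.mem_singleton_iff.1 hf, comp_zero]
    exact Or.inr rfl

theorem principalRightIdeal_le_row {A B : C} (s : B ⟶ A) :
    principalRightIdeal s ≤ row A := by
  intro x hx p hp
  rcases hx p with ⟨h, -⟩ | h
  · exact absurd h hp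
  · exact h

theorem of_mem_principalRightIdeal {A B X : C} {s : B ⟶ A} {f : X ⟶ A} :
    of (A, X) f ∈ principalRightIdeal s ↔ ∃ g : X ⟶ B, f = g ≫ s := by
  refine of_mem_gradedSubgroup.trans ⟨?_, ?_⟩
  · rintro (⟨h, g, hg⟩ | h)
    · exact ⟨g, by simpa using hg⟩
    · exact ⟨0, by rw [zero_comp]; exact h⟩
  · rintro ⟨g, rfl⟩
    exact Or.inl ⟨rfl, g, by simp⟩

theorem principalRightIdeal_comp_le {A B X : C} (s : B ⟶ A) (g : X ⟶ B) :
    principalRightIdeal (g ≫ s) ≤ principalRightIdeal s := by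
  intro x hx p
  rcases hx p with ⟨h, k, hk⟩ | h
  · exact Or.inl ⟨h, k ≫ g, by rw [hk]; simp⟩
  · exact Or.inr h

/-- Without simple morphisms into `A`, every nonzero `s` has a nonzero multiple `g ≫ s` that no
longer generates `s`. Iterating from `𝟙 A` gives a strictly descending chain of principal right
ideals. -/
theorem ArtinianCatRing.exists_isSimpleMor (hC : ArtinianCatRing C) {A : C} (hA : 𝟙 A ≠ 0) :
    ∃ (B : C) (s : B ⟶ A), IsSimpleMor s := by
  by_contra! H
  let T := {s : Σ B : C, (B ⟶ A) // s.2 ≠ 0}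
  have step (s : T) : ∃ t : T, (∃ g : t.1.1 ⟶ s.1.1, t.1.2 = g ≫ s.1.2) ∧
      ∀ h : s.1.1 ⟶ t.1.1, h ≫ t.1.2 ≠ s.1.2 := by
    have hs := H _ s.1.2
    simp only [IsSimpleMor, not_and] at hs
    have := hs s.2
    push Not at this
    obtain ⟨B', g, hg, h⟩ := this
    exact ⟨⟨⟨B', g ≫ s.1.2⟩, hg⟩, ⟨g, rfl⟩, h⟩
  choose next hle hlt using step
  let s : ℕ → T := fun i => next^[i] ⟨⟨A, 𝟙 A⟩, hA⟩
  have hs (i : ℕ) : s (i + 1) = next (s i) := Function.iterate_succ_apply' next i _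
  obtain ⟨m, hm⟩ := hC A (fun i => principalRightIdeal (s i).1.2)
    (antitone_nat_of_succ_le fun i => by
      obtain ⟨g, hg⟩ := hle (s i)
      rw [hs, hg]
      exact principalRightIdeal_comp_le _ g)
    (fun i => isGradedRightIdeal_principalRightIdeal _)
    (fun i => principalRightIdeal_le_row _)
  have hmem : of (A, (s m).1.1) (s m).1.2 ∈ principalRightIdeal (s (m + 1)).1.2 := by
    rw [hm (m + 1) (Nat.le_succ m)]
    exact of_mem_principalRightIdeal.2 ⟨𝟙 _, by simp⟩
  rw [hs] at hmem
  obtain ⟨g, hg⟩ := of_mem_principalRightIdeal.1 hmem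
  exact hlt (s m) g hg.symm

end GradedIdeals

/-! ### Simple objects and subobjects in the category of additive functors. -/

section AdditiveFunctors

variable {C : Type u} [Category.{v} C] [Preadditive C] {F G H : Cᵒᵖ ⥤+ AddCommGrpCat.{v}}

/-- The component of a morphism of additive functors. -/
def component (α : F ⟶ G) (X : Cᵒᵖ) : F.obj.obj X →+ G.obj.obj X := (α.hom.app X).hom

theorem component_naturality (α : F ⟶ G) {X Y : Cᵒᵖ} (f : X ⟶ Y) (x : F.obj.obj X) :
    component α Y ((F.obj.map f).hom x) = (G.obj.map f).hom (component α X x) :=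
  congrArg (fun t => AddCommGrpCat.Hom.hom t x) (α.hom.naturality f)

theorem component_comp (α : F ⟶ G) (β : G ⟶ H) (X : Cᵒᵖ) (x : F.obj.obj X) :
    component (α ≫ β) X x = component β X (component α X x) := rfl

theorem hom_ext_component {α β : F ⟶ G} (h : ∀ X x, component α X x = component β X x) :
    α = β := by
  apply InducedCategory.hom_ext
  ext X x
  exact h X x

theorem component_sum {ι : Type*} [Fintype ι] (α : ι → (F ⟶ G)) (X : Cᵒᵖ) (x : F.obj.obj X) :
    component (∑ i, α i) X x = ∑ i, component (α i) X x :=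
  map_sum (AddMonoidHom.mk' (fun β : F ⟶ G => component β X x) fun _ _ => rfl) α _

/-- The morphism of additive functors with given components. -/
def ofComponents (t : ∀ X, F.obj.obj X →+ G.obj.obj X)
    (ht : ∀ {X Y : Cᵒᵖ} (f : X ⟶ Y) (x : F.obj.obj X),
      t Y ((F.obj.map f).hom x) = (G.obj.map f).hom (t X x)) : F ⟶ G :=
  ObjectProperty.homMk
    { app := fun X => AddCommGrpCat.ofHom (t X)
      naturality := fun X Y f => by
        ext x
        exact ht f x }

theorem map_id_apply (F : Cᵒᵖ ⥤+ AddCommGrpCat.{v}) {X : Cᵒᵖ} (x : F.obj.obj X) :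
    (F.obj.map (𝟙 X)).hom x = x := by
  rw [F.obj.map_id]
  rfl

theorem map_comp_apply (F : Cᵒᵖ ⥤+ AddCommGrpCat.{v}) {X Y Z : Cᵒᵖ} (f : X ⟶ Y) (g : Y ⟶ Z)
    (x : F.obj.obj X) :
    (F.obj.map (f ≫ g)).hom x = (F.obj.map g).hom ((F.obj.map f).hom x) := by
  rw [F.obj.map_comp]
  rfl

theorem map_add_apply (F : Cᵒᵖ ⥤+ AddCommGrpCat.{v}) {X Y : Cᵒᵖ} (f g : X ⟶ Y)
    (x : F.obj.obj X) :
    (F.obj.map (f + g)).hom x = (F.obj.map f).hom x + (F.obj.map g).hom x := by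
  rw [F.obj.map_add]
  rfl

/-- The morphism `C(-,B) ⟶ F` corresponding to an element of `F B`. -/
def yonedaHom {B : C} (x : F.obj.obj (op B)) : representable B ⟶ F :=
  ofComponents
    (fun X => AddMonoidHom.mk' (fun f : X.unop ⟶ B => (F.obj.map f.op).hom x)
      fun f g => map_add_apply F f.op g.op x)
    fun {X Y} f g => by
      change X.unop ⟶ B at g
      exact map_comp_apply F g.op f x

/-- By Yoneda, elements with the same image are two morphisms from a representable that `α`
equalises. -/
theorem component_injective (α : F ⟶ G) [Mono α] (X : Cᵒᵖ) :
    Function.Injective (component α X) := by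
  intro x y h
  have hxy : yonedaHom (B := X.unop) x = yonedaHom y := by
    rw [← cancel_mono α]
    refine hom_ext_component fun Y f => ?_
    change component α Y ((F.obj.map (Quiver.Hom.op (show Y.unop ⟶ X.unop from f))).hom x) =
      component α Y ((F.obj.map (Quiver.Hom.op (show Y.unop ⟶ X.unop from f))).hom y)
    rw [component_naturality, component_naturality, h]
  have h1 : component (yonedaHom (B := X.unop) x) X (𝟙 X.unop) =
      component (yonedaHom (B := X.unop) y) X (𝟙 X.unop) := by rw [hxy]
  rwa [← map_id_apply F x, ← map_id_apply F y]

theorem mono_of_component_injective (α : F ⟶ G)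
    (h : ∀ X, Function.Injective (component α X)) : Mono α :=
  ⟨fun {_} β γ hβγ => hom_ext_component fun X x => h X (by
    rw [← component_comp, ← component_comp, hβγ])⟩

/-- Injectivity of `β` forces the pointwise choices of preimages to be additive and natural. -/
theorem exists_lift (α : F ⟶ G) (β : H ⟶ G) (hβ : ∀ X, Function.Injective (component β X))
    (h : ∀ X x, ∃ y, component β X y = component α X x) : ∃ γ : F ⟶ H, γ ≫ β = α := by
  choose t ht using h
  refine ⟨ofComponents (fun X => AddMonoidHom.mk' (t X) fun x y => hβ X ?_)
    fun {X Y} f x => hβ Y ?_, hom_ext_component fun X x => ht X x⟩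
  · rw [map_add, ht, ht, ht, map_add]
  · change component β Y (t Y _) = component β Y ((H.obj.map f).hom (t X x))
    rw [ht, component_naturality, component_naturality, ht]

theorem isIso_of_component_bijective (α : F ⟶ G)
    (h : ∀ X, Function.Bijective (component α X)) : IsIso α := by
  obtain ⟨γ, hγ⟩ := exists_lift (𝟙 G) α (fun X => (h X).1) fun X x => (h X).2 x
  have := mono_of_component_injective α fun X => (h X).1
  exact ⟨γ, by rw [← cancel_mono α, Category.assoc, hγ, Category.comp_id, Category.id_comp], hγ⟩

theorem component_surjective (α : F ⟶ G) [IsIso α] (X : Cᵒᵖ) :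
    Function.Surjective (component α X) := fun x =>
  ⟨component (inv α) X x, by rw [← component_comp, IsIso.inv_hom_id]; rfl⟩

/-- The image of a morphism of additive functors. -/
def imageFunctor (α : F ⟶ G) : Cᵒᵖ ⥤+ AddCommGrpCat.{v} where
  obj :=
    { obj := fun X => AddCommGrpCat.of (component α X).range
      map := fun {X Y} f => AddCommGrpCat.ofHom
        (((G.obj.map f).hom.comp (component α X).range.subtype).codRestrict
          (component α Y).range (by
            rintro ⟨_, x, rfl⟩
            exact ⟨(F.obj.map f).hom x, component_naturality α f x⟩))
      map_id := fun X => by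
        exact AddCommGrpCat.hom_ext (AddMonoidHom.ext fun x => Subtype.ext (map_id_apply G x.1))
      map_comp := fun f g => by
        exact AddCommGrpCat.hom_ext (AddMonoidHom.ext fun x => Subtype.ext (map_comp_apply G f g x.1)) }
  property := ⟨fun {X Y f g} => by
    exact AddCommGrpCat.hom_ext (AddMonoidHom.ext fun x => Subtype.ext (map_add_apply G f g x.1))⟩

/-- The inclusion of the image of a morphism. -/
def imageInclusion (α : F ⟶ G) : imageFunctor α ⟶ G :=
  ofComponents (fun X => (component α X).range.subtype) fun _ _ => rfl

/-- The subfunctor generated by `x`, the image of its Yoneda morphism, is nonzero, hence all of `F`.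
-/
theorem exists_map_eq_of_simple [Simple F] {B : C} {x : F.obj.obj (op B)} (hx : x ≠ 0) {B' : C}
    (y : F.obj.obj (op B')) : ∃ f : B' ⟶ B, (F.obj.map f.op).hom x = y := by
  have : Mono (imageInclusion (yonedaHom x)) :=
    mono_of_component_injective _ fun _ => Subtype.val_injective
  have hne : imageInclusion (yonedaHom x) ≠ 0 := by
    intro h
    apply hx
    have h0 : component (imageInclusion (yonedaHom x)) (op B) ⟨x, 𝟙 B, map_id_apply F x⟩ = 0 := by
      rw [h]
      rfl
    exact h0
  have := isIso_of_mono_of_nonzero hne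
  obtain ⟨⟨_, f, hf⟩, rfl⟩ := component_surjective (imageInclusion (yonedaHom x)) (op B') y
  exact ⟨f, hf⟩

/-- Any nonzero value `s = α(x)` works: if `g ≫ s` is nonzero, then so is the restriction of `x`
along `g`, which therefore generates `x`. -/
theorem exists_isSimpleMor_of_simple [Simple F] {A : C} (α : F ⟶ representable A) (hα : α ≠ 0) :
    ∃ (B : C) (s : B ⟶ A), IsSimpleMor s := by
  obtain ⟨X, x, hx⟩ : ∃ X x, component α X x ≠ 0 := by
    by_contra! h
    exact hα (hom_ext_component h)
  refine ⟨X.unop, component α X x, hx, fun B' g hg => ?_⟩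
  have hg' : component α (op B') ((F.obj.map g.op).hom x) ≠ 0 := by
    rw [component_naturality]
    exact hg
  obtain ⟨h, hh⟩ := exists_map_eq_of_simple (F := F) (B := B') (x := (F.obj.map g.op).hom x)
    (fun h0 => hg' (by rw [h0, map_zero])) (B' := X.unop) x
  refine ⟨h, ?_⟩
  have := congrArg (component α X) hh
  rw [component_naturality α h.op, component_naturality α g.op] at this
  exact this

theorem id_representable_ne_zero {A : C} (hA : 𝟙 A ≠ 0) : 𝟙 (representable A) ≠ 0 := by
  intro h
  apply hA
  have : component (𝟙 (representable A)) (op A) (𝟙 A) = 0 := by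
    rw [h]
    rfl
  exact this

instance : (additiveFunctor Cᵒᵖ AddCommGrpCat.{v}).ContainsZero where
  exists_zero := by
    have h : IsZero ((Functor.const Cᵒᵖ).obj (AddCommGrpCat.of PUnit.{v + 1})) :=
      Functor.isZero _ fun _ =>
        AddCommGrpCat.isZero_of_subsingleton (AddCommGrpCat.of PUnit.{v + 1})
    exact ⟨_, h, Functor.Additive.of_isZero h⟩

theorem RightArtinianCategory.exists_isSimpleMor (hC : RightArtinianCategory C) {A : C}
    (hA : 𝟙 A ≠ 0) : ∃ (B : C) (s : B ⟶ A), IsSimpleMor s := by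
  have := hC A
  obtain ⟨Y, hY⟩ := exists_simple_subobject (X := representable A)
    fun h => id_representable_ne_zero hA (h.eq_of_src _ _)
  exact exists_isSimpleMor_of_simple Y.arrow fun h => id_nonzero (Y : Cᵒᵖ ⥤+ AddCommGrpCat.{v}) (by
    rw [← cancel_mono Y.arrow, h, comp_zero, comp_zero])

theorem SemisimpleCategory.exists_isSimpleMor (hC : SemisimpleCategory C) {A : C}
    (hA : 𝟙 A ≠ 0) : ∃ (B : C) (s : B ⟶ A), IsSimpleMor s := by
  obtain ⟨ι, S, i, hS, ⟨hi⟩⟩ := hC A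
  obtain ⟨j, hj⟩ : ∃ j, i j ≠ 0 := by
    by_contra! h
    refine id_representable_ne_zero hA (hi.hom_ext fun j => ?_)
    change i j.as ≫ _ = i j.as ≫ _
    rw [h, zero_comp, zero_comp]
  have := hS j
  exact exists_isSimpleMor_of_simple (i j) hj

/-- The right ideal of `C` given by a subobject of `C(-,A)`. -/
def subobjectRightIdeal {A : C} (Y : Subobject (representable A)) : RightIdeal A where
  carrier B := (component Y.arrow (op B)).range
  comp_mem := by
    rintro B' B f _ ⟨x, rfl⟩
    exact ⟨((Y : Cᵒᵖ ⥤+ AddCommGrpCat.{v}).obj.map f.op).hom x,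
      component_naturality Y.arrow f.op x⟩

theorem le_of_subobjectRightIdeal_le {A : C} {Y Z : Subobject (representable A)}
    (h : subobjectRightIdeal Y ≤ subobjectRightIdeal Z) : Y ≤ Z := by
  obtain ⟨γ, hγ⟩ := exists_lift Y.arrow Z.arrow (fun X => component_injective Z.arrow X)
    fun X x => h X.unop ⟨x, rfl⟩
  exact Subobject.le_of_comm γ hγ

theorem subobjectRightIdeal_mono {A : C} {Y Z : Subobject (representable A)} (h : Y ≤ Z) :
    subobjectRightIdeal Y ≤ subobjectRightIdeal Z := by
  rintro B _ ⟨x, rfl⟩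
  refine ⟨component (Subobject.ofLE Y Z h) (op B) x, ?_⟩
  rw [← component_comp, Subobject.ofLE_arrow]

/-! ### Artinian and semisimple representables from matrices. -/

namespace MatrixPresentation

variable {D : Type v} [DivisionRing D] (W : MatrixPresentation C D)

include W in
theorem rightArtinianCategory (hC : ∃ A : C, 𝟙 A ≠ 0) : RightArtinianCategory C := by
  intro A
  rw [isArtinianObject_iff_antitone_chain_condition]
  intro f
  obtain ⟨m, hm⟩ := W.rightIdeal_chain_condition hC
    (fun i => subobjectRightIdeal (OrderDual.ofDual (f i)))
    fun i j hij => subobjectRightIdeal_mono (f.monotone hij)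
  exact ⟨m, fun i hi => le_antisymm (le_of_subobjectRightIdeal_le (hm i hi).ge)
    (le_of_subobjectRightIdeal_le (hm i hi).le)⟩

/-- The functor of row vectors. -/
def rowFunctor : Cᵒᵖ ⥤+ AddCommGrpCat.{v} where
  obj :=
    { obj := fun X => AddCommGrpCat.of (Fin (W.size X.unop) → D)
      map := fun {X Y} f => AddCommGrpCat.ofHom
        (AddMonoidHom.mk' (fun v => Matrix.vecMul v (W.toMatrix Y.unop X.unop f.unop))
          fun v w => Matrix.add_vecMul _ v w)
      map_id := fun X => by
        refine AddCommGrpCat.hom_ext (AddMonoidHom.ext fun v => ?_)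
        change Fin (W.size X.unop) → D at v
        change Matrix.vecMul v (W.toMatrix X.unop X.unop (𝟙 X.unop)) = v
        rw [W.toMatrix_id, Matrix.vecMul_one]
      map_comp := fun {X Y Z} f g => by
        refine AddCommGrpCat.hom_ext (AddMonoidHom.ext fun v => ?_)
        change Fin (W.size X.unop) → D at v
        change Matrix.vecMul v (W.toMatrix Z.unop X.unop (g.unop ≫ f.unop)) =
          Matrix.vecMul (Matrix.vecMul v (W.toMatrix Y.unop X.unop f.unop))
            (W.toMatrix Z.unop Y.unop g.unop)
        rw [W.toMatrix_comp, Matrix.vecMul_vecMul] }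
  property := ⟨fun {X Y f g} => by
    refine AddCommGrpCat.hom_ext (AddMonoidHom.ext fun v => ?_)
    change Fin (W.size X.unop) → D at v
    change Matrix.vecMul v (W.toMatrix Y.unop X.unop (f.unop + g.unop)) =
      Matrix.vecMul v (W.toMatrix Y.unop X.unop f.unop) +
        Matrix.vecMul v (W.toMatrix Y.unop X.unop g.unop)
    rw [map_add, Matrix.vecMul_add]⟩

theorem exists_rowFunctor_map_eq {A B : C} {v : Fin (W.size A) → D} (hv : v ≠ 0)
    (w : Fin (W.size B) → D) :
    ∃ f : B ⟶ A, Matrix.vecMul v (W.toMatrix B A f) = w := by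
  obtain ⟨i, hi⟩ := Function.ne_iff.1 hv
  -- Only row `i` is nonzero, scaled to cancel the nonzero entry `v i`.
  refine ⟨W.mor (Matrix.of fun k l => if k = i then (v i)⁻¹ * w l else 0), ?_⟩
  ext l
  simp [Matrix.vecMul, dotProduct, mul_inv_cancel_left₀ hi]

/-- A nonzero row vector is carried to any row vector by some morphism, so a nonzero monomorphism
into the row functor is onto. A nonzero object, of positive size, makes the functor nonzero. -/
theorem simple_rowFunctor (hC : ∃ A : C, 𝟙 A ≠ 0) : Simple W.rowFunctor := by
  obtain ⟨A, hA⟩ := hC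
  refine ⟨fun {F} α _ => ⟨?_, fun hα => ?_⟩⟩
  · rintro h rfl
    obtain ⟨x, hx⟩ := component_surjective (0 : F ⟶ W.rowFunctor) (op A)
      (fun _ => 1 : Fin (W.size A) → D)
    exact one_ne_zero (congrFun hx ⟨0, W.size_pos hA⟩).symm
  · obtain ⟨X, x, hx⟩ : ∃ X x, component α X x ≠ 0 := by
      by_contra! h
      exact hα (hom_ext_component h)
    refine isIso_of_component_bijective α fun Y => ⟨component_injective α Y, fun w => ?_⟩
    obtain ⟨f, hf⟩ := W.exists_rowFunctor_map_eq (A := X.unop) (B := Y.unop) hx w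
    exact ⟨(F.obj.map f.op).hom x, (component_naturality α f.op x).trans hf⟩

/-- The matrix with row `v` in position `j`. -/
def rowMatrix {k l : ℕ} (j : Fin k) : (Fin l → D) →+ Matrix (Fin k) (Fin l) D where
  toFun v := Matrix.of fun i b => if i = j then v b else 0
  map_zero' := by ext; simp
  map_add' v w := by
    ext i b
    by_cases h : i = j <;> simp [h]

theorem rowMatrix_self {k l : ℕ} (j : Fin k) (v : Fin l → D) : rowMatrix j v j = v := by
  ext b
  simp [rowMatrix]

theorem rowMatrix_of_ne {k l : ℕ} {i j : Fin k} (h : i ≠ j) (v : Fin l → D) :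
    rowMatrix j v i = 0 := by
  ext b
  simp [rowMatrix, h]

theorem rowMatrix_mul {k l m : ℕ} (j : Fin k) (v : Fin l → D) (M : Matrix (Fin l) (Fin m) D) :
    rowMatrix j v * M = rowMatrix j (Matrix.vecMul v M) := by
  ext a b
  by_cases h : a = j <;> simp [h, rowMatrix, Matrix.mul_apply, Matrix.vecMul, dotProduct]

theorem sum_rowMatrix {k l : ℕ} (M : Matrix (Fin k) (Fin l) D) : ∑ j, rowMatrix j (M j) = M := by
  ext a b
  simp [rowMatrix, Matrix.sum_apply]

/-- The inclusion of the row vectors as the `j`-th rows of matrices. -/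
def rowInclusion (A : C) (j : Fin (W.size A)) : W.rowFunctor ⟶ representable A :=
  ofComponents
    (fun X => (W.mor : _ ≃+ (X.unop ⟶ A)).toAddMonoidHom.comp (rowMatrix j))
    fun {X Y} f v => by
      change Fin (W.size X.unop) → D at v
      change (W.mor (rowMatrix j (Matrix.vecMul v (W.toMatrix Y.unop X.unop f.unop))) :
        Y.unop ⟶ A) = f.unop ≫ W.mor (rowMatrix j v)
      rw [← rowMatrix_mul, ← mor_comp_mor, mor_toMatrix]

/-- The projection of matrices to their `j`-th rows. -/
def rowProjection (A : C) (j : Fin (W.size A)) : representable A ⟶ W.rowFunctor :=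
  ofComponents
    (fun X => (Pi.evalAddMonoidHom (fun _ => Fin (W.size X.unop) → D) j).comp
      (W.toMatrix X.unop A).toAddMonoidHom)
    fun {X Y} f g => by
      change X.unop ⟶ A at g
      change W.toMatrix Y.unop A (f.unop ≫ g) j =
        Matrix.vecMul (W.toMatrix X.unop A g j) (W.toMatrix Y.unop X.unop f.unop)
      rw [W.toMatrix_comp]
      rfl

theorem rowInclusion_projection_self (A : C) (j : Fin (W.size A)) :
    W.rowInclusion A j ≫ W.rowProjection A j = 𝟙 _ := by
  refine hom_ext_component fun X v => ?_
  change Fin (W.size X.unop) → D at v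
  change W.toMatrix X.unop A (W.mor (rowMatrix j v)) j = v
  rw [toMatrix_mor, rowMatrix_self]

theorem rowInclusion_projection_of_ne (A : C) {i j : Fin (W.size A)} (h : j ≠ i) :
    W.rowInclusion A i ≫ W.rowProjection A j = 0 := by
  refine hom_ext_component fun X v => ?_
  change Fin (W.size X.unop) → D at v
  change W.toMatrix X.unop A (W.mor (rowMatrix i v)) j = 0
  rw [toMatrix_mor, rowMatrix_of_ne h]

theorem sum_rowProjection_inclusion (A : C) :
    ∑ j, W.rowProjection A j ≫ W.rowInclusion A j = 𝟙 (representable A) := by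
  refine hom_ext_component fun X f => ?_
  refine (component_sum _ X f).trans ?_
  change X.unop ⟶ A at f
  change ∑ j, W.mor (rowMatrix j (W.toMatrix X.unop A f j)) = f
  rw [← map_sum, sum_rowMatrix, mor_toMatrix]

-- Splitting matrices into rows exhibits `C(-,A)` as a direct sum of `W.size A` copies of the simple
-- row functor, possibly none.
include W in
theorem semisimpleCategory (hC : ∃ A : C, 𝟙 A ≠ 0) : SemisimpleCategory C := by
  intro A
  refine ⟨ULift (Fin (W.size A)), fun _ => W.rowFunctor, fun j => W.rowInclusion A j.down,
    fun _ => W.simple_rowFunctor hC, ⟨Cofan.IsColimit.mk _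
      (fun t => ∑ j, W.rowProjection A j ≫ t.inj ⟨j⟩) (fun t j => ?_) fun t m hm => ?_⟩⟩
  · change W.rowInclusion A j.down ≫ _ = _
    rw [Preadditive.comp_sum, Finset.sum_eq_single j.down]
    · rw [← Category.assoc, rowInclusion_projection_self, Category.id_comp]
    · intro i _ hi
      rw [← Category.assoc, rowInclusion_projection_of_ne W A hi, zero_comp]
    · simp
  · change representable A ⟶ _ at m
    rw [← Category.id_comp m, ← sum_rowProjection_inclusion W A, Preadditive.sum_comp]
    exact Finset.sum_congr rfl fun j _ => by
      rw [Category.assoc]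
      exact congrArg _ (hm ⟨j⟩)

end MatrixPresentation

end AdditiveFunctors

end PreaddCat

end

/-! ### The equivalences. -/

theorem mainTheorem11 (C : Type u) [Category.{v} C] [Preadditive C]
    (hC : ∃ A : C, 𝟙 A ≠ 0) :
    List.TFAE [
      -- (1) `C` is a simple artinian category
      PreaddCat.SimpleArtinianCategory C,
      -- (2) `C` is a simple and semisimple category
      PreaddCat.SimpleCategory C ∧ PreaddCat.SemisimpleCategory C,
      -- (3) `R[C]` is a gr-simple `𝒢₀`-artinian ring
      PreaddCat.GrSimpleCatRing C ∧ PreaddCat.ArtinianCatRing C,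
      -- (4) compatible matrix descriptions of the morphism groups over one division ring
      ∃ (D : Type v) (_ : DivisionRing D) (n : C → ℕ)
        (φ : ∀ A B : C, (A ⟶ B) ≃+ Matrix (Fin (n B)) (Fin (n A)) D),
        ∀ (A X B : C) (g : A ⟶ X) (f : X ⟶ B), φ A B (g ≫ f) = φ X B f * φ A X g,
      -- (5) `C` is isomorphic to a small full subcategory of f.g. modules over a division ring
      ∃ (D : Type v) (_ : DivisionRing D), PreaddCat.IsoToFullSubcatFGMod C D,
      -- (6) `C` is isomorphic to a small full subcategory of f.g. modules over a simple
      -- artinian ring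
      ∃ (R : Type v) (_ : Ring R), IsSimpleRing R ∧ IsArtinianRing R ∧
        PreaddCat.IsoToFullSubcatFGMod C R] := by
  tfae_have 1 → 5 := fun ⟨h, hs⟩ =>
    let ⟨_, hA⟩ := hC
    let ⟨_, _, hm⟩ := h.exists_isSimpleMor hA
    hm.exists_divisionRing hs
  tfae_have 2 → 5 := fun ⟨hs, h⟩ =>
    let ⟨_, hA⟩ := hC
    let ⟨_, _, hm⟩ := h.exists_isSimpleMor hA
    hm.exists_divisionRing hs
  tfae_have 3 → 5 := fun ⟨hs, h⟩ =>
    let ⟨_, hA⟩ := hC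
    let ⟨_, _, hm⟩ := h.exists_isSimpleMor hA
    hm.exists_divisionRing hs.simpleCategory
  tfae_have 5 → 6 := fun ⟨D, _, h⟩ => ⟨D, inferInstance, inferInstance, inferInstance, h⟩
  tfae_have 6 → 4 := fun ⟨_, _, _, _, h⟩ => PreaddCat.exists_matrix_of_isoToFullSubcatFGMod h
  tfae_have 4 → 1 := fun ⟨D, _, n, φ, hφ⟩ =>
    let W : PreaddCat.MatrixPresentation C D := ⟨n, φ, hφ _ _ _⟩
    ⟨W.rightArtinianCategory hC, W.simpleCategory hC⟩
  tfae_have 4 → 2 := fun ⟨D, _, n, φ, hφ⟩ =>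
    let W : PreaddCat.MatrixPresentation C D := ⟨n, φ, hφ _ _ _⟩
    ⟨W.simpleCategory hC, W.semisimpleCategory hC⟩
  tfae_have 4 → 3 := fun ⟨D, _, n, φ, hφ⟩ =>
    let W : PreaddCat.MatrixPresentation C D := ⟨n, φ, hφ _ _ _⟩
    ⟨(W.simpleCategory hC).grSimpleCatRing, W.artinianCatRing hC⟩
  tfae_finish
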